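/- All sets are finite, and digraphs may have parallel arcs. A \emph{root} of a digraph is a vertex entered by no arc. A \emph{matroid-rooted digraph} $(D,\mathcal M)$ consists of a digraph $D=(V\cup R,A)$, with $V$ and $R$ disjoint, in which every vertex of $R$ is a root (with any number of outgoing arcs), and a matroid $\mathcal M$ with ground set $R$ and rank function $r_{\mathcal M}$. For $X\subseteq V\cup R$, let $d_A^-(X)$ be the number of arcs with head in $X$ and tail outside $X$, and let $P_X^D$ be the set of vertices from which at least one vertex of $X$ can be reached by a directed path (possibly of length $0$) in $D$; write $P_v^D=P_{\{v\}}^D$. An \emph{$r$-arborescence} is a digraph whose underlying graph is a tree, such that no arc enters $r$ and exactly one arc enters each other vertex. A \emph{matroid-reachability-based packing of arborescences} in $(D,\mathcal M)$ is a family $\{B_r\}_{r\in R}$ of pairwise arc-disjoint subdigraphs of $D$ such that $B_r$ is an $r$-arborescence for every $r\in R$ and, for every $v\in V$, the set $\{r\in R: v\in V(B_r)\}$ is a basis of $P_v^D\cap R$ in $\mathcal M$ (a maximal independent subset of it). \textbf{Theorem.} Let $(D=(V\cup R,A),\mathcal M=(R,r_{\mathcal M}))$ be a matroid-rooted digraph.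 Then there exists a matroid-reachability-based packing of arborescences in $(D,\mathcal M)$ if and only if for all $X\subseteq V\cup R$ with $X\cap V\neq\emptyset$, $$d_A^-(X)\ \ge\ r_{\mathcal M}(P_X^D\cap R)-r_{\mathcal M}(X\cap R).$$ -/

import Mathlib

/-- A directed multigraph: vertices form a set in `α`, arcs form a set in `β`, and every arc has a
tail and a head. Parallel arcs (and loops) are allowed; the values of `tail` and `head` outside
`arcSet` carry no meaning. -/
structure MultiDigraph (α β : Type*) where
  vertexSet : Set α
  arcSet : Set β
  tail : β → α
  head : β → α
  tail_mem : ∀ a ∈ arcSet, tail a ∈ vertexSet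
  head_mem : ∀ a ∈ arcSet, head a ∈ vertexSet

namespace MultiDigraph

/-- `ρ⁻(X)`: the arcs entering `X`, with head in `X` and tail outside `X`. -/
def inArcs {α β : Type*} (D : MultiDigraph α β) (X : Set α) : Set β :=
  {a | a ∈ D.arcSet ∧ D.head a ∈ X ∧ D.tail a ∉ X}

/-- `d⁻(X)`: the number of arcs entering `X`. -/
noncomputable def inDeg {α β : Type*} (D : MultiDigraph α β) (X : Set α) : ℕ∞ :=
  (D.inArcs X).encard

/-- A root of `D` is a vertex entered by no arc. -/
def IsRoot {α β : Type*} (D : MultiDigraph α β) (r : α) : Prop :=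
  r ∈ D.vertexSet ∧ D.inDeg {r} = 0

/-- Some arc of `D` goes from `u` to `v`. -/
def HasArc {α β : Type*} (D : MultiDigraph α β) (u v : α) : Prop :=
  ∃ a ∈ D.arcSet, D.tail a = u ∧ D.head a = v

/-- `v` is reachable from `u`: there is a directed path, possibly of length zero, from `u`
to `v`. -/
def Reachable {α β : Type*} (D : MultiDigraph α β) (u v : α) : Prop :=
  Relation.ReflTransGen D.HasArc u v

/-- `P_X`: the vertices from which at least one vertex of `X` is reachable. -/
def reachingSet {α β : Type*} (D : MultiDigraph α β) (X : Set α) : Set α :=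
  {u | u ∈ D.vertexSet ∧ ∃ v ∈ X, D.Reachable u v}

/-- `B` is a subdigraph of `D`. -/
structure IsSubdigraph {α β : Type*} (B D : MultiDigraph α β) : Prop where
  vertexSet_subset : B.vertexSet ⊆ D.vertexSet
  arcSet_subset : B.arcSet ⊆ D.arcSet
  tail_eq : ∀ a ∈ B.arcSet, B.tail a = D.tail a
  head_eq : ∀ a ∈ B.arcSet, B.head a = D.head a

/-- The adjacency relation of the underlying undirected graph, as a simple graph. -/
def underlyingSimpleGraph {α β : Type*} (B : MultiDigraph α β) : SimpleGraph B.vertexSet :=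
  SimpleGraph.fromRel fun u v => B.HasArc u v

/-- The underlying undirected multigraph is a tree: it has no loops and no two arcs with the same
pair of ends, and it is connected (in particular nonempty) and acyclic. -/
structure UnderlyingIsTree {α β : Type*} (B : MultiDigraph α β) : Prop where
  loopless : ∀ a ∈ B.arcSet, B.tail a ≠ B.head a
  no_parallel : Set.InjOn (fun a => s(B.tail a, B.head a)) B.arcSet
  isTree : B.underlyingSimpleGraph.IsTree

/-- An arborescence: the underlying graph is a tree, and exactly one arc enters each vertex except
one. -/
def IsArborescence {α β : Type*} (B : MultiDigraph α β) : Prop :=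
  B.UnderlyingIsTree ∧ ∃ r ∈ B.vertexSet, ∀ v ∈ B.vertexSet, B.inDeg {v} = 1 ↔ v ≠ r

/-- An `r`-arborescence: an arborescence whose root is `r`. -/
def IsArborescenceFrom {α β : Type*} (B : MultiDigraph α β) (r : α) : Prop :=
  B.IsArborescence ∧ B.IsRoot r

/-- `(D, M)` is a matroid-rooted digraph with vertex set the disjoint union of `V` and `R`, where
`R` is a set of roots of `D` and `M` is a matroid with ground set `R`. -/
structure IsMatroidRooted {α β : Type*} (D : MultiDigraph α β) (V R : Set α) (M : Matroid α) :
    Prop where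
  vertexSet_eq : D.vertexSet = V ∪ R
  disjoint : Disjoint V R
  isRoot : ∀ r ∈ R, D.IsRoot r
  ground_eq : M.E = R

/-- The family `(B r)_{r ∈ R}` is a packing of arborescences in `D`, with `B r` rooted at `r`. -/
structure IsRootedPacking {α β : Type*} (D : MultiDigraph α β) (R : Set α)
    (B : α → MultiDigraph α β) : Prop where
  isSubdigraph : ∀ r ∈ R, (B r).IsSubdigraph D
  isArborescenceFrom : ∀ r ∈ R, (B r).IsArborescenceFrom r
  arcDisjoint : R.PairwiseDisjoint fun r => (B r).arcSet

/-- The packing `(B r)_{r ∈ R}` is matroid-reachability-based: for every `v ∈ V`, the roots of the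
arborescences containing `v` form a basis of `P_v ∩ R` in `M`. -/
structure IsMatroidReachabilityBasedPacking {α β : Type*} (D : MultiDigraph α β) (V R : Set α)
    (M : Matroid α) (B : α → MultiDigraph α β) : Prop where
  isRootedPacking : D.IsRootedPacking R B
  isBasis : ∀ v ∈ V, M.IsBasis {r | r ∈ R ∧ v ∈ (B r).vertexSet} (D.reachingSet {v} ∩ R)

end MultiDigraph

/-!
Necessity is a counting argument: a root outside `X` whose arborescence meets `X` contributes an arc
entering `X`, these arcs are distinct, and together with `X ∩ R` these roots span `P_X ∩ R`
(`IsMatroidReachabilityBasedPacking.eRk_le`).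

For sufficiency the arborescences are grown arc by arc, from the single vertices of `R`. Write
`T(x) = P_x ∩ R` for the roots that can reach `x` and `f(x)` for the roots whose arborescence has
already reached `x`. A move takes an unused arc `a` from `u` to `v` and some `s ∈ f(u)` outside the
closure of `f(v)`, and adds `a` to the arborescence of `s`; it keeps the sets `f(v)`, `v ∈ V`,
independent. If no vertex is deficient any more, that is, if `f(x)` spans `T(x)` for all `x`, the
packing is as required.

The vertices are split into levels according to the value of `T`, and `T` is monotone along arcs. For
each level `S` the partial packing is required to satisfy a cut condition: if `X` contains a vertex
of the level, then `r(S)` is at most the number of unused arcs entering `X` with head on the level,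
plus the rank of the union over `y ∈ X` of `f(y)` for `y` on the level and of `T(y)` for the other `y`.
This follows initially from the hypothesis (`IsMatroidRooted.isExtendable_init`), and a move with head
on one level does not influence the conditions of the other levels.

To find a move that preserves the condition, take a deficient vertex with `T` minimal, and its level
`S`. The tails of arcs into this level are on the level or not deficient. A move from `u` to `v` with
the root `s` is forbidden only by a tight set containing `v` but not `u` whose span contains `s`. On
one level the required rank `r(S)` is constant, so tight sets sharing a vertex of the level uncross
(`tight_inter`). In a minimal tight set `X` whose span is larger than that of one of its vertices `w`
on the level, the subset of vertices with span inside that of `w` is entered by more arcs than `X`,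
hence by an arc inside `X` that allows a move; a tight set forbidding it would meet `X` in a smaller
tight set of the same kind (`exists_safe_arc`).
-/

/-! ### Ranks as natural numbers -/

namespace Matroid

/-- The rank of a set as a natural number. It is `0` by convention on sets of infinite rank, so it
is only used in matroids of finite rank. -/
noncomputable def natRk {α : Type*} (M : Matroid α) (X : Set α) : ℕ := (M.eRk X).toNat

variable {α : Type*} {M : Matroid α} [M.RankFinite] {X Y : Set α}

lemma coe_natRk (M : Matroid α) [M.RankFinite] (X : Set α) : (M.natRk X : ℕ∞) = M.eRk X :=
  ENat.natCast_toNat (eRk_ne_top_iff.2 (M.isRkFinite_set X))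

lemma natRk_mono (M : Matroid α) [M.RankFinite] (h : X ⊆ Y) : M.natRk X ≤ M.natRk Y := by
  have := M.eRk_mono h
  rw [← coe_natRk, ← coe_natRk] at this
  exact_mod_cast this

lemma natRk_closure (M : Matroid α) (X : Set α) : M.natRk (M.closure X) = M.natRk X := by
  simp [natRk]

/-- Submodularity of the rank, with the intersection of the two sets enlarged to the intersection
of their closures. -/
lemma natRk_closure_inter_add_natRk_union_le (M : Matroid α) [M.RankFinite] (X Y : Set α) :
    M.natRk (M.closure X ∩ M.closure Y) + M.natRk (X ∪ Y) ≤ M.natRk X + M.natRk Y := by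
  have := M.eRk_inter_add_eRk_union_le (M.closure X) (M.closure Y)
  rw [eRk_union_closure_left_eq, eRk_union_closure_right_eq, eRk_closure_eq, eRk_closure_eq] at this
  simp only [← coe_natRk] at this
  exact_mod_cast this

lemma subset_closure_of_natRk_le (hXY : X ⊆ Y) (hY : Y ⊆ M.E) (h : M.natRk Y ≤ M.natRk X) :
    Y ⊆ M.closure X := by
  have h' : M.eRk Y ≤ M.eRk X := by
    rw [← coe_natRk, ← coe_natRk]; exact_mod_cast h
  rw [(M.isRkFinite_set X).closure_eq_closure_of_subset_of_eRk_ge_eRk hXY h']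
  exact M.subset_closure Y hY

end Matroid

/-! ### Tight sets and safe arcs -/

namespace MultiDigraph

section SafeArc

variable {α β : Type*}

/-- The arcs of `A` that enter `X`, for a set `A` of arcs with ends given by `tail` and `head`. -/
def entering (tail head : β → α) (A : Set β) (X : Set α) : Set β :=
  {a | a ∈ A ∧ head a ∈ X ∧ tail a ∉ X}

lemma entering_finite (tail head : β → α) {A : Set β} (hA : A.Finite) (X : Set α) :
    (entering tail head A X).Finite :=
  hA.subset fun _ h => h.1

lemma ncard_entering_inter_add_union_le (tail head : β → α) {A : Set β} (hA : A.Finite)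
    (X Y : Set α) :
    (entering tail head A (X ∩ Y)).ncard + (entering tail head A (X ∪ Y)).ncard ≤
      (entering tail head A X).ncard + (entering tail head A Y).ncard := by
  have hf := entering_finite tail head hA
  rw [← Set.ncard_union_add_ncard_inter _ _ (hf _) (hf _),
    ← Set.ncard_union_add_ncard_inter _ _ (hf X) (hf Y)]
  refine add_le_add (Set.ncard_le_ncard ?_ ((hf _).union (hf _)))
    (Set.ncard_le_ncard ?_ ((hf _).inter_of_left _))
  all_goals
    intro a
    simp only [entering, Set.mem_union, Set.mem_inter_iff, Set.mem_ofPred_eq]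
    tauto

/-- Tight sets meeting `K` in a common vertex uncross: the closures of their spans meet in the
closure of the span of their intersection. -/
lemma tight_inter (M : Matroid α) [M.RankFinite] {A : Set β} (hA : A.Finite) (tail head : β → α)
    {K : Set α} {F : α → Set α} (hFE : ∀ x, F x ⊆ M.E) {k : ℕ}
    (hcond : ∀ X : Set α, (X ∩ K).Nonempty →
      k ≤ (entering tail head A X).ncard + M.natRk (⋃ x ∈ X, F x))
    {X Y : Set α} (hXY : (X ∩ Y ∩ K).Nonempty)
    (hX : (entering tail head A X).ncard + M.natRk (⋃ x ∈ X, F x) = k)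
    (hY : (entering tail head A Y).ncard + M.natRk (⋃ x ∈ Y, F x) = k) :
    (entering tail head A (X ∩ Y)).ncard + M.natRk (⋃ x ∈ X ∩ Y, F x) = k ∧
      M.closure (⋃ x ∈ X, F x) ∩ M.closure (⋃ x ∈ Y, F x) ⊆ M.closure (⋃ x ∈ X ∩ Y, F x) := by
  have h1 := hcond (X ∩ Y) hXY
  have h2 := hcond (X ∪ Y) (hXY.mono fun x hx => ⟨Or.inl hx.1.1, hx.2⟩)
  have h3 := ncard_entering_inter_add_union_le tail head hA X Y
  have h4 := M.natRk_closure_inter_add_natRk_union_le (⋃ x ∈ X, F x) (⋃ x ∈ Y, F x)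
  rw [← Set.biUnion_union] at h4
  have hE : ∀ W : Set α, (⋃ x ∈ W, F x) ⊆ M.E := fun W => Set.iUnion₂_subset fun x _ => hFE x
  have hsub : (⋃ x ∈ X ∩ Y, F x) ⊆ M.closure (⋃ x ∈ X, F x) ∩ M.closure (⋃ x ∈ Y, F x) :=
    Set.subset_inter
      ((Set.biUnion_subset_biUnion_left Set.inter_subset_left).trans (M.subset_closure _ (hE X)))
      ((Set.biUnion_subset_biUnion_left Set.inter_subset_right).trans (M.subset_closure _ (hE Y)))
  have h5 := M.natRk_mono hsub
  refine ⟨by omega, Matroid.subset_closure_of_natRk_le hsub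
    (Set.inter_subset_left.trans (M.closure_subset_ground _)) (by omega)⟩

/-- If every set meeting `K` satisfies the cut condition and some vertex of `K` has deficient rank,
then some arc `a` and some element `s` available at its tail can be used up, adding `s` to the span
of the head of `a`, without violating the cut condition. The available elements `G x` span `F x`, and `F'` is any
enlargement of `F` that accounts for the move. -/
lemma exists_safe_arc (M : Matroid α) [M.RankFinite] {A : Set β} (hA : A.Finite)
    (tail head : β → α) {Z K : Set α} (hZ : Z.Finite) (hKZ : K ⊆ Z)
    (hhead : ∀ a ∈ A, head a ∈ K) (htail : ∀ a ∈ A, tail a ∈ Z)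
    {F G : α → Set α} (hFE : ∀ x, F x ⊆ M.E) (hGF : ∀ x, G x ⊆ F x)
    (hFG : ∀ x ∈ Z, F x ⊆ M.closure (G x)) {k : ℕ}
    (hcond : ∀ X : Set α, (X ∩ K).Nonempty →
      k ≤ (entering tail head A X).ncard + M.natRk (⋃ x ∈ X, F x))
    (hk : M.natRk (⋃ x ∈ Z, F x) ≤ k) {v : α} (hv : v ∈ K) (hvk : M.natRk (F v) < k) :
    ∃ a ∈ A, ∃ s ∈ G (tail a), s ∉ M.closure (F (head a)) ∧
      ∀ (F' : α → Set α), (∀ x, F x ⊆ F' x) → s ∈ F' (head a) →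
        ∀ X : Set α, (X ∩ K).Nonempty →
          k ≤ (entering tail head (A \ {a}) X).ncard + M.natRk (⋃ x ∈ X, F' x) := by
  have hE : ∀ W : Set α, (⋃ x ∈ W, F x) ⊆ M.E := fun W => Set.iUnion₂_subset fun x _ => hFE x
  have hf := entering_finite tail head hA
  by_contra! hbad
  -- The obstruction to a move is a tight set containing the head, not the tail, and spanning `s`.
  have hobs : ∀ a ∈ A, ∀ s ∈ G (tail a), s ∉ M.closure (F (head a)) →
      ∃ X : Set α, (entering tail head A X).ncard + M.natRk (⋃ x ∈ X, F x) = k ∧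
        head a ∈ X ∧ tail a ∉ X ∧ s ∈ M.closure (⋃ x ∈ X, F x) := by
    intro a ha s hs hsa
    obtain ⟨F', hFF', hsF', X, hXK, hlt⟩ := hbad a ha s hs hsa
    have h1 := hcond X hXK
    have h2 : M.natRk (⋃ x ∈ X, F x) ≤ M.natRk (⋃ x ∈ X, F' x) :=
      M.natRk_mono (Set.iUnion₂_mono fun x _ => hFF' x)
    have hdiff : entering tail head (A \ {a}) X = entering tail head A X \ {a} := by
      ext b
      simp only [entering, Set.mem_sdiff, Set.mem_ofPred_eq, Set.mem_singleton_iff]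
      tauto
    rw [hdiff] at hlt
    have haX : a ∈ entering tail head A X := by
      by_contra hn
      rw [Set.sdiff_singleton_eq_self hn] at hlt
      omega
    have h3 := Set.ncard_sdiff_singleton_add_one haX (hf X)
    refine ⟨X, by omega, haX.2.1, haX.2.2, ?_⟩
    have hsE : s ∈ M.E := hFE _ (hGF _ hs)
    have h4 : M.natRk (insert s (⋃ x ∈ X, F x)) ≤ M.natRk (⋃ x ∈ X, F' x) := by
      refine M.natRk_mono (Set.insert_subset (Set.mem_biUnion haX.2.1 hsF') ?_)
      exact Set.iUnion₂_mono fun x _ => hFF' x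
    exact Matroid.subset_closure_of_natRk_le (Set.subset_insert _ _)
      (Set.insert_subset hsE (hE X)) (by omega) (Set.mem_insert _ _)
  -- `Z` is tight, and among the tight sets of nonconstant span a minimal one is chosen.
  let 𝒯 : Set (Set α) := {X | X ⊆ Z ∧ (entering tail head A X).ncard + M.natRk (⋃ x ∈ X, F x) = k ∧
    ∃ w ∈ X ∩ K, ∃ s ∈ M.closure (⋃ x ∈ X, F x), s ∉ M.closure (F w)}
  have h𝒯 : 𝒯.Finite := hZ.finite_subsets.subset fun X hX => hX.1
  have hZ𝒯 : Z ∈ 𝒯 := by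
    have h0 : entering tail head A Z = ∅ := by
      ext a
      simp only [entering, Set.mem_ofPred_eq, Set.mem_empty_iff_false, iff_false]
      exact fun h => h.2.2 (htail a h.1)
    have h1 := hcond Z ⟨v, hKZ hv, hv⟩
    rw [h0, Set.ncard_empty, zero_add] at h1
    refine ⟨subset_rfl, by rw [h0, Set.ncard_empty]; omega, v, ⟨hKZ hv, hv⟩, ?_⟩
    by_contra! hcl
    have h2 : M.natRk (⋃ x ∈ Z, F x) ≤ M.natRk (F v) := by
      rw [← M.natRk_closure (F v), ← M.natRk_closure]
      exact M.natRk_mono hcl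
    omega
  obtain ⟨X, hX⟩ := h𝒯.exists_minimal ⟨Z, hZ𝒯⟩
  obtain ⟨hXZ, hXt, w, ⟨hwX, hwK⟩, s, hs, hsw⟩ := hX.prop
  -- `Y` has the rank of the single vertex `w`, hence smaller rank than `X`.
  let Y : Set α := {y | y ∈ X ∧ F y ⊆ M.closure (F w)}
  have hwY : w ∈ Y := ⟨hwX, M.subset_closure _ (hFE w)⟩
  have hYr : M.natRk (⋃ x ∈ Y, F x) ≤ M.natRk (F w) := by
    rw [← M.natRk_closure (F w)]
    exact M.natRk_mono (Set.iUnion₂_subset fun y hy => hy.2)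
  have hXr : M.natRk (F w) < M.natRk (⋃ x ∈ X, F x) := by
    by_contra! hle
    refine hsw (M.closure_subset_closure_of_subset_closure ?_ hs)
    exact Matroid.subset_closure_of_natRk_le (Set.subset_biUnion_of_mem hwX) (hE X) hle
  have hYc := hcond Y ⟨w, hwY, hwK⟩
  -- More arcs enter `Y` than `X`, so one of them has its tail in `X`.
  obtain ⟨a, haY, haX⟩ : ∃ a ∈ entering tail head A Y, a ∉ entering tail head A X := by
    by_contra! hsub
    have := Set.ncard_le_ncard hsub (hf X)
    omega
  have haA : a ∈ A := haY.1
  have hhX : head a ∈ X := haY.2.1.1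
  have htX : tail a ∈ X := by
    by_contra hn
    exact haX ⟨haA, hhX, hn⟩
  have htF : ¬ F (tail a) ⊆ M.closure (F w) := fun h => haY.2.2 ⟨htX, h⟩
  have htG : ¬ G (tail a) ⊆ M.closure (F w) := fun h =>
    htF ((hFG _ (htail a haA)).trans (M.closure_subset_closure_of_subset_closure h))
  obtain ⟨t, htG, htw⟩ := Set.not_subset.1 htG
  have hth : t ∉ M.closure (F (head a)) := fun h =>
    htw (M.closure_subset_closure_of_subset_closure haY.2.1.2 h)
  obtain ⟨X', hX't, hhX', htX', htcl⟩ := hobs a haA t htG hth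
  have hhK := hhead a haA
  obtain ⟨hI, hIcl⟩ := tight_inter M hA tail head hFE hcond ⟨head a, ⟨hhX, hhX'⟩, hhK⟩ hXt hX't
  have hmem : X ∩ X' ∈ 𝒯 := by
    refine ⟨Set.inter_subset_left.trans hXZ, hI, head a, ⟨⟨hhX, hhX'⟩, hhK⟩, t, hIcl ⟨?_, htcl⟩, hth⟩
    exact M.subset_closure _ (hE X) (Set.mem_biUnion htX (hGF _ htG))
  exact htX' (hX.le_of_le hmem Set.inter_subset_left htX).2

end SafeArc

end MultiDigraph

/-! ### Subdigraphs grown from a root -/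

namespace MultiDigraph

section Grown

variable {α β : Type*} {D : MultiDigraph α β} {r : α} {N : Set α} {C : Set β}

/-- `D.IsGrown r N C`: the vertex set `N` and the arc set `C` arise from the single vertex `r` by
repeatedly adding an arc of `D` that leaves the current vertex set, together with its head. -/
inductive IsGrown (D : MultiDigraph α β) (r : α) : Set α → Set β → Prop
  | root : D.IsGrown r {r} ∅
  | step {N : Set α} {C : Set β} {a : β} : D.IsGrown r N C → a ∈ D.arcSet → D.tail a ∈ N →
      D.head a ∉ N → D.IsGrown r (insert (D.head a) N) (insert a C)

lemma IsGrown.root_mem (h : D.IsGrown r N C) : r ∈ N := by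
  induction h with
  | root => rfl
  | step _ _ _ _ ih => exact Or.inr ih

lemma IsGrown.subset_vertexSet (h : D.IsGrown r N C) (hr : r ∈ D.vertexSet) :
    N ⊆ D.vertexSet := by
  induction h with
  | root => simpa using hr
  | step _ ha _ _ ih => exact Set.insert_subset (D.head_mem _ ha) ih

lemma IsGrown.subset_arcSet (h : D.IsGrown r N C) : C ⊆ D.arcSet := by
  induction h with
  | root => simp
  | step _ ha _ _ ih => exact Set.insert_subset ha ih

lemma IsGrown.tail_mem (h : D.IsGrown r N C) : ∀ a ∈ C, D.tail a ∈ N := by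
  induction h with
  | root => simp
  | step _ _ ht _ ih =>
    rintro b (rfl | hb)
    · exact Or.inr ht
    · exact Or.inr (ih b hb)

lemma IsGrown.head_mem (h : D.IsGrown r N C) : ∀ a ∈ C, D.head a ∈ N := by
  induction h with
  | root => simp
  | step _ _ _ _ ih =>
    rintro b (rfl | hb)
    · exact Or.inl rfl
    · exact Or.inr (ih b hb)

lemma IsGrown.head_ne_root (h : D.IsGrown r N C) : ∀ a ∈ C, D.head a ≠ r := by
  induction h with
  | root => simp
  | step h _ _ hh ih =>
    rintro b (rfl | hb)
    · rintro rfl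
      exact hh h.root_mem
    · exact ih b hb

lemma IsGrown.tail_ne_head (h : D.IsGrown r N C) : ∀ a ∈ C, D.tail a ≠ D.head a := by
  induction h with
  | root => simp
  | step _ _ ht hh ih =>
    rintro b (rfl | hb)
    · intro he
      exact hh (he ▸ ht)
    · exact ih b hb

lemma IsGrown.exists_head_eq (h : D.IsGrown r N C) : ∀ v ∈ N, v ≠ r → ∃ a ∈ C, D.head a = v := by
  induction h with
  | root => simp
  | step _ _ _ _ ih =>
    rintro v (rfl | hv) hvr
    · exact ⟨_, Or.inl rfl, rfl⟩
    · obtain ⟨a, ha, rfl⟩ := ih v hv hvr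
      exact ⟨a, Or.inr ha, rfl⟩

lemma IsGrown.injOn_head (h : D.IsGrown r N C) : Set.InjOn D.head C := by
  induction h with
  | root => simp
  | step h _ _ hh ih =>
    rintro b (rfl | hb) c (rfl | hc) hbc
    · rfl
    · exact absurd (hbc ▸ h.head_mem c hc) hh
    · exact absurd (hbc ▸ h.head_mem b hb) hh
    · exact ih hb hc hbc

lemma IsGrown.injOn_ends (h : D.IsGrown r N C) :
    Set.InjOn (fun a => s(D.tail a, D.head a)) C := by
  induction h with
  | root => simp
  | step h _ _ hh ih =>
    rintro b (rfl | hb) c (rfl | hc) hbc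
    · rfl
    · rcases Sym2.eq_iff.1 hbc with ⟨-, h2⟩ | ⟨-, h2⟩
      · exact absurd (h2 ▸ h.head_mem c hc) hh
      · exact absurd (h2 ▸ h.tail_mem c hc) hh
    · rcases Sym2.eq_iff.1 hbc with ⟨-, h2⟩ | ⟨h2, -⟩
      · exact absurd (h2 ▸ h.head_mem b hb) hh
      · exact absurd (h2 ▸ h.tail_mem b hb) hh
    · exact ih hb hc hbc

lemma IsGrown.encard_eq (h : D.IsGrown r N C) : N.encard = C.encard + 1 := by
  induction h with
  | root => simp
  | step h _ _ hh ih =>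
    rw [Set.encard_insert_of_notMem hh, ih,
      Set.encard_insert_of_notMem fun ha => hh (h.head_mem _ ha)]

lemma IsGrown.reachable (h : D.IsGrown r N C) : ∀ v ∈ N, D.Reachable r v := by
  induction h with
  | root =>
    rintro v rfl
    exact Relation.ReflTransGen.refl
  | step _ ha ht _ ih =>
    rintro v (rfl | hv)
    · exact (ih _ ht).tail ⟨_, ha, rfl, rfl⟩
    · exact ih v hv

/-- The subdigraph of `D` with vertex set `N` and arc set `C`, grown from `r`. -/
def IsGrown.toDigraph (h : D.IsGrown r N C) : MultiDigraph α β where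
  vertexSet := N
  arcSet := C
  tail := D.tail
  head := D.head
  tail_mem := h.tail_mem
  head_mem := h.head_mem

lemma IsGrown.reachable_underlying (h : D.IsGrown r N C) (B : MultiDigraph α β)
    (hB : B.tail = D.tail ∧ B.head = D.head) (hN : N ⊆ B.vertexSet) (hC : C ⊆ B.arcSet)
    (v : α) (hv : v ∈ N) :
    B.underlyingSimpleGraph.Reachable ⟨r, hN h.root_mem⟩ ⟨v, hN hv⟩ := by
  induction h generalizing v with
  | root =>
    obtain rfl := hv
    rfl
  | @step N C a h ha ht hh ih =>
    have hN' : N ⊆ B.vertexSet := (Set.subset_insert _ _).trans hN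
    have hC' : C ⊆ B.arcSet := (Set.subset_insert _ _).trans hC
    rcases hv with rfl | hv
    · refine (ih hN' hC' _ ht).trans (SimpleGraph.Adj.reachable ?_)
      refine (SimpleGraph.fromRel_adj _ _ _).2 ⟨fun he => hh ?_, Or.inl ⟨a, hC (Or.inl rfl), ?_, ?_⟩⟩
      · rw [← Subtype.mk.inj he]
        exact ht
      · rw [hB.1]
      · rw [hB.2]
    · exact ih hN' hC' v hv

/-- The underlying graph is connected with one vertex more than arcs, hence a tree. -/
lemma IsGrown.isTree (h : D.IsGrown r N C) (hN : N.Finite) :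
    h.toDigraph.underlyingSimpleGraph.IsTree := by
  have : Finite h.toDigraph.vertexSet := hN
  have hconn : h.toDigraph.underlyingSimpleGraph.Connected := by
    have hr := h.reachable_underlying h.toDigraph ⟨rfl, rfl⟩ subset_rfl subset_rfl
    have : Nonempty h.toDigraph.vertexSet := ⟨⟨r, h.root_mem⟩⟩
    exact ⟨fun u v => (hr u u.2).symm.trans (hr v v.2)⟩
  rw [SimpleGraph.isTree_iff_connected_and_card]
  refine ⟨hconn, le_antisymm ?_ hconn.card_vert_le_card_edgeSet_add_one⟩
  have hC : C.Finite := by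
    have := h.encard_eq
    rw [← Set.encard_ne_top_iff] at hN ⊢
    intro hc
    exact hN (by rw [this, hc, top_add])
  have hcard : N.ncard = C.ncard + 1 := by
    have := h.encard_eq
    rw [← hN.cast_ncard_eq, ← hC.cast_ncard_eq] at this
    exact_mod_cast this
  have hV : Nat.card h.toDigraph.vertexSet = C.ncard + 1 := by
    rw [Nat.card_coe_set_eq]
    exact hcard
  rw [hV, Nat.card_coe_set_eq]
  refine Nat.succ_le_succ ?_
  rw [← Set.ncard_image_of_injective _ (Sym2.map.injective Subtype.val_injective)]
  refine (Set.ncard_le_ncard ?_ (hC.image fun a => s(D.tail a, D.head a))).trans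
    (Set.ncard_image_le hC)
  rintro _ ⟨e, he, rfl⟩
  induction e with
  | _ u v =>
    obtain ⟨-, ⟨a, ha, h1, h2⟩ | ⟨a, ha, h1, h2⟩⟩ := (SimpleGraph.fromRel_adj _ _ _).1
      ((SimpleGraph.mem_edgeSet _).1 he)
    · exact ⟨a, ha, by simp [← h1, ← h2, toDigraph]⟩
    · exact ⟨a, ha, by simp [← h1, ← h2, toDigraph, Sym2.eq_swap]⟩

lemma IsGrown.isArborescenceFrom (h : D.IsGrown r N C) (hN : N.Finite) :
    h.toDigraph.IsArborescenceFrom r := by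
  have hroot : h.toDigraph.inDeg {r} = 0 := by
    rw [inDeg, Set.encard_eq_zero, Set.eq_empty_iff_forall_notMem]
    exact fun a ha => h.head_ne_root a ha.1 ha.2.1
  refine ⟨⟨⟨h.tail_ne_head, h.injOn_ends, h.isTree hN⟩, r, h.root_mem, fun v hv => ⟨?_, ?_⟩⟩,
    h.root_mem, hroot⟩
  · rintro h1 rfl
    simp [hroot] at h1
  · intro hvr
    obtain ⟨a, ha, rfl⟩ := h.exists_head_eq v hv hvr
    rw [inDeg, Set.encard_eq_one]
    refine ⟨a, Set.eq_singleton_iff_unique_mem.2 ⟨⟨ha, rfl, h.tail_ne_head a ha⟩, ?_⟩⟩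
    exact fun b hb => h.injOn_head hb.1 ha hb.2.1

lemma IsGrown.isSubdigraph (h : D.IsGrown r N C) (hr : r ∈ D.vertexSet) :
    h.toDigraph.IsSubdigraph D :=
  ⟨h.subset_vertexSet hr, h.subset_arcSet, fun _ _ => rfl, fun _ _ => rfl⟩

end Grown

/-! ### Necessity of the cut condition -/

section Necessity

variable {α β : Type*} {D B : MultiDigraph α β} {r : α}

/-- In an `r`-arborescence every vertex is reachable from `r` by a directed path: the vertices that
are so reachable are closed under adjacency, because an arc entering this set would be a second arc
entering its head, or an arc entering `r`. -/
lemma IsArborescenceFrom.reachable (h : B.IsArborescenceFrom r) {v : α} (hv : v ∈ B.vertexSet) :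
    B.Reachable r v := by
  obtain ⟨⟨htree, r', hr', hdeg⟩, hr, hr0⟩ := h
  obtain rfl : r = r' := by
    by_contra hne
    have := (hdeg r hr).2 hne
    simp [hr0] at this
  obtain ⟨p⟩ := htree.isTree.connected.preconnected ⟨r, hr⟩ ⟨v, hv⟩
  suffices H : ∀ (x y : B.vertexSet) (_ : B.underlyingSimpleGraph.Walk x y),
      B.Reachable r x → B.Reachable r y from H _ _ p Relation.ReflTransGen.refl
  intro x y p
  induction p with
  | nil => exact id
  | @cons x y z hadj _ ih =>
    intro hx
    refine ih ?_
    obtain ⟨hne, hxy | ⟨a, ha, hat, hah⟩⟩ := (SimpleGraph.fromRel_adj _ _ _).1 hadj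
    · exact hx.tail hxy
    · -- The reversed arc `a` enters `x`, so `x` is not the root.
      have hax : a ∈ B.inArcs {(x : α)} := by
        refine ⟨ha, hah, fun he => hne (Subtype.ext ?_)⟩
        rw [← hat]
        exact he.symm
      have hxr : (x : α) ≠ r := by
        intro he
        rw [inDeg, Set.encard_eq_zero] at hr0
        rw [he, hr0] at hax
        exact hax.elim
      rcases Relation.ReflTransGen.cases_tail hx with he | ⟨w, hw, b, hb, hbt, hbh⟩
      · exact absurd he hxr
      · have hbx : b ∈ B.inArcs {(x : α)} :=
          ⟨hb, hbh, fun he => htree.loopless b hb (he.trans hbh.symm)⟩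
        have h1 := (hdeg x x.2).2 hxr
        rw [inDeg] at h1
        have hab : a = b := Set.encard_le_one_iff.1 h1.le a b hax hbx
        rw [← hat, hab, hbt]
        exact hw

lemma Reachable.exists_inArc {u v : α} (h : D.Reachable u v) {X : Set α} (hu : u ∉ X)
    (hv : v ∈ X) : (D.inArcs X).Nonempty := by
  induction h with
  | refl => exact absurd hv hu
  | @tail w x _ hwx ih =>
    by_cases hw : w ∈ X
    · exact ih hw
    · obtain ⟨a, ha, rfl, rfl⟩ := hwx
      exact ⟨a, ha, hv, hw⟩

/-- The roots outside `X` whose arborescences meet `X` each contribute an arc entering `X`, and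
together with `X ∩ R` they span the roots reaching `X`. -/
theorem IsMatroidReachabilityBasedPacking.eRk_le {V R : Set α} {M : Matroid α}
    {B : α → MultiDigraph α β} (hD : D.IsMatroidRooted V R M)
    (h : D.IsMatroidReachabilityBasedPacking V R M B) {X : Set α} (hX : X ⊆ V ∪ R) :
    M.eRk (D.reachingSet X ∩ R) ≤ D.inDeg X + M.eRk (X ∩ R) := by
  obtain ⟨⟨hsub, harb, hdis⟩, hbas⟩ := h
  let Q : Set α := {r | r ∈ R ∧ r ∉ X ∧ ((B r).vertexSet ∩ X).Nonempty}
  have hQE : Q ∪ X ∩ R ⊆ M.E := by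
    rw [hD.ground_eq]
    exact Set.union_subset (fun r hr => hr.1) Set.inter_subset_right
  have hspan : D.reachingSet X ∩ R ⊆ M.closure (Q ∪ X ∩ R) := by
    rintro r ⟨⟨hrD, v, hvX, hrv⟩, hrR⟩
    rcases hX hvX with hvV | hvR
    · refine M.closure_subset_closure ?_ ((hbas v hvV).subset_closure ⟨⟨hrD, v, rfl, hrv⟩, hrR⟩)
      rintro s ⟨hsR, hvs⟩
      by_cases hsX : s ∈ X
      · exact Or.inr ⟨hsX, hsR⟩
      · exact Or.inl ⟨hsR, hsX, v, hvs, hvX⟩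
    · -- Nothing but `v` itself reaches the root `v`.
      have hrv' : r = v := by
        by_contra hne
        obtain ⟨a, ha⟩ := hrv.exists_inArc (X := {v}) hne rfl
        have h0 := (hD.isRoot v hvR).2
        rw [inDeg, Set.encard_eq_zero] at h0
        rw [h0] at ha
        exact ha
      subst hrv'
      exact M.subset_closure _ hQE (Or.inr ⟨hvX, hvR⟩)
  have harc : ∀ r ∈ Q, ∃ a, a ∈ (B r).arcSet ∧ a ∈ D.inArcs X := by
    rintro r ⟨hrR, hrX, v, hvB, hvX⟩
    obtain ⟨a, ha, hh, ht⟩ := ((harb r hrR).reachable hvB).exists_inArc hrX hvX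
    refine ⟨a, ha, (hsub r hrR).arcSet_subset ha, ?_, ?_⟩
    · rwa [← (hsub r hrR).head_eq a ha]
    · rwa [← (hsub r hrR).tail_eq a ha]
  have hQ : Q.encard ≤ D.inDeg X := by
    rcases Q.eq_empty_or_nonempty with hQ | ⟨q, hq⟩
    · simp [hQ]
    have : Nonempty β := ⟨(harc q hq).choose⟩
    choose! g hg hgX using harc
    refine Set.encard_le_encard_of_injOn hgX fun r hr s hs hrs => ?_
    by_contra hne
    exact Set.disjoint_left.1 (hdis hr.1 hs.1 hne) (hg r hr) (hrs ▸ hg s hs)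
  calc M.eRk (D.reachingSet X ∩ R) ≤ M.eRk (Q ∪ X ∩ R) := by
        rw [← M.eRk_closure_eq (Q ∪ X ∩ R)]
        exact M.eRk_mono hspan
    _ ≤ Q.encard + M.eRk (X ∩ R) := M.eRk_union_le_encard_add_eRk _ _
    _ ≤ D.inDeg X + M.eRk (X ∩ R) := by
        gcongr

end Necessity

end MultiDigraph

/-! ### Sufficiency of the cut condition -/

namespace MultiDigraph

section Sufficiency

variable {α β : Type*} {D : MultiDigraph α β} {V R : Set α} {M : Matroid α}

/-- `T(x) = P_x ∩ R`: the roots from which `x` is reachable. -/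
def reachingRoots (D : MultiDigraph α β) (R : Set α) (x : α) : Set α :=
  D.reachingSet {x} ∩ R

lemma mem_reachingRoots {r x : α} (hR : R ⊆ D.vertexSet) :
    r ∈ D.reachingRoots R x ↔ r ∈ R ∧ D.Reachable r x := by
  simp only [reachingRoots, reachingSet, Set.mem_inter_iff, Set.mem_ofPred_eq,
    Set.mem_singleton_iff, exists_eq_left]
  exact ⟨fun h => ⟨h.2, h.1.2⟩, fun h => ⟨⟨hR h.1, h.2⟩, h.1⟩⟩

lemma reachingRoots_tail_subset (hR : R ⊆ D.vertexSet) {a : β} (ha : a ∈ D.arcSet) :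
    D.reachingRoots R (D.tail a) ⊆ D.reachingRoots R (D.head a) := by
  intro r hr
  rw [mem_reachingRoots hR] at hr ⊢
  exact ⟨hr.1, hr.2.tail ⟨a, ha, rfl, rfl⟩⟩

lemma IsMatroidRooted.subset_vertexSet (hD : D.IsMatroidRooted V R M) : R ⊆ D.vertexSet :=
  fun r hr => (hD.isRoot r hr).1

lemma IsMatroidRooted.tail_eq_of_head_mem (hD : D.IsMatroidRooted V R M) {a : β}
    (ha : a ∈ D.arcSet) (hr : D.head a ∈ R) : D.tail a = D.head a := by
  have h0 := (hD.isRoot _ hr).2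
  rw [inDeg, Set.encard_eq_zero] at h0
  by_contra hne
  exact (h0 ▸ (⟨ha, rfl, hne⟩ : a ∈ D.inArcs {D.head a}) : a ∈ (∅ : Set β))

lemma IsMatroidRooted.reachable_root (hD : D.IsMatroidRooted V R M) {r u : α} (hr : r ∈ R)
    (hu : D.Reachable u r) : u = r := by
  induction hu with
  | refl => rfl
  | tail _ hwr ih =>
    obtain ⟨a, ha, rfl, rfl⟩ := hwr
    have := hD.tail_eq_of_head_mem ha hr
    rw [← this]
    exact ih (this ▸ hr)

lemma IsMatroidRooted.reachingRoots_root (hD : D.IsMatroidRooted V R M) {r : α} (hr : r ∈ R) :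
    D.reachingRoots R r = {r} := by
  ext s
  rw [mem_reachingRoots hD.subset_vertexSet]
  constructor
  · exact fun h => hD.reachable_root hr h.2
  · rintro rfl
    exact ⟨hr, Relation.ReflTransGen.refl⟩

/-- The roots whose current vertex set contains `x`. -/
def rootsAt (R : Set α) (N : α → Set α) (x : α) : Set α :=
  {r | r ∈ R ∧ x ∈ N r}

/-- The arcs of `D` not used by any of the arc sets `C r`. -/
def unused (D : MultiDigraph α β) (R : Set α) (C : α → Set β) : Set β :=
  {a | a ∈ D.arcSet ∧ ∀ r ∈ R, a ∉ C r}

open Classical in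
/-- The span attached to `y` at level `S`: the roots that have arrived at `y` if `y` lies on the
level `S`, and all roots that can reach `y` otherwise. -/
noncomputable def levelSpan (D : MultiDigraph α β) (R : Set α) (N : α → Set α) (S : Set α)
    (y : α) : Set α :=
  if D.reachingRoots R y = S then rootsAt R N y else D.reachingRoots R y

/-- The unused arcs whose head lies on the level `S`. -/
def levelArcs (D : MultiDigraph α β) (R : Set α) (C : α → Set β) (S : Set α) : Set β :=
  {a | a ∈ D.unused R C ∧ D.reachingRoots R (D.head a) = S}

/-- The vertices `x` with `T(x) = S`. -/
def level (D : MultiDigraph α β) (R : Set α) (S : Set α) : Set α :=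
  {x | x ∈ D.vertexSet ∧ D.reachingRoots R x = S}

/-- A partial packing that can still be completed: arc-disjoint grown subdigraphs `(N r, C r)`
such that the roots arrived at each vertex of `V` are independent, together with a cut condition
on each level. The cut condition at the level `S` counts only arcs with head on that level and treats
the vertices of the other levels as saturated, so extending the packing on one level does not affect
the conditions on the others. -/
structure IsExtendable (D : MultiDigraph α β) (V R : Set α) (M : Matroid α) (N : α → Set α)
    (C : α → Set β) : Prop where
  isGrown : ∀ r ∈ R, D.IsGrown r (N r) (C r)
  arcDisjoint : R.PairwiseDisjoint C
  indep : ∀ v ∈ V, M.Indep (rootsAt R N v)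
  cut : ∀ S X : Set α, (X ∩ D.level R S).Nonempty →
    M.natRk S ≤ (entering D.tail D.head (D.levelArcs R C S) X).ncard +
      M.natRk (⋃ y ∈ X, D.levelSpan R N S y)

variable {N : α → Set α} {C : α → Set β}

lemma rootsAt_subset (hR : R ⊆ D.vertexSet) (hN : ∀ r ∈ R, D.IsGrown r (N r) (C r)) (x : α) :
    rootsAt R N x ⊆ D.reachingRoots R x := fun r hr =>
  (mem_reachingRoots hR).2 ⟨hr.1, (hN r hr.1).reachable x hr.2⟩

/-- The hypothesis of the theorem gives the cut condition on every level before any arc is used. For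
a set `X` and a level `S`, the hypothesis is applied to the part of `X` on the level together with
everything that reaches the rest of `X`. -/
lemma IsMatroidRooted.isExtendable_init [M.RankFinite] (hA : D.arcSet.Finite)
    (hD : D.IsMatroidRooted V R M)
    (h : ∀ X : Set α, X ⊆ V ∪ R → (X ∩ V).Nonempty →
      M.eRk (D.reachingSet X ∩ R) ≤ D.inDeg X + M.eRk (X ∩ R)) :
    D.IsExtendable V R M (fun r => {r}) fun _ => ∅ := by
  have hR := hD.subset_vertexSet
  refine ⟨fun r _ => .root, fun _ _ _ _ _ => Set.disjoint_empty _, fun v hv => ?_, ?_⟩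
  · have : rootsAt R (fun r => {r}) v = ∅ := by
      ext r
      simp only [rootsAt, Set.mem_ofPred_eq, Set.mem_singleton_iff, Set.mem_empty_iff_false,
        iff_false, not_and]
      rintro hr rfl
      exact Set.disjoint_left.1 hD.disjoint hv hr
    rw [this]
    exact M.empty_indep
  -- If the vertex of `X` on the level `S` is a root, it spans its level on its own.
  rintro S X ⟨x, hxX, hxD, hxS⟩
  rw [hD.vertexSet_eq] at hxD
  rcases hxD with hxV | hxR
  · let X₁ : Set α := {y | y ∈ X ∧ y ∈ D.vertexSet ∧ D.reachingRoots R y = S}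
    let X₂ : Set α := {y | y ∈ X ∧ D.reachingRoots R y ≠ S}
    have hY := h (X₁ ∪ D.reachingSet X₂)
      (by rw [← hD.vertexSet_eq]; exact Set.union_subset (fun y hy => hy.2.1) fun y hy => hy.1)
      ⟨x, Or.inl ⟨hxX, by rw [hD.vertexSet_eq]; exact Or.inl hxV, hxS⟩, hxV⟩
    have hS : S ⊆ D.reachingSet (X₁ ∪ D.reachingSet X₂) ∩ R := by
      rw [← hxS]
      rintro r ⟨⟨hr, y, rfl, hry⟩, hrR⟩
      exact ⟨⟨hr, y, Or.inl ⟨hxX, by rw [hD.vertexSet_eq]; exact Or.inl hxV, hxS⟩, hry⟩, hrR⟩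
    have hin : D.inArcs (X₁ ∪ D.reachingSet X₂) ⊆
        entering D.tail D.head (D.levelArcs R (fun _ => ∅) S) X := by
      rintro a ⟨ha, hh, ht⟩
      have hh₁ : D.head a ∈ X₁ := by
        refine hh.resolve_right fun ⟨_, y, hy, hhy⟩ => ht (Or.inr ⟨D.tail_mem a ha, y, hy, ?_⟩)
        exact Relation.ReflTransGen.head ⟨a, ha, rfl, rfl⟩ hhy
      refine ⟨⟨⟨ha, fun _ _ => id⟩, hh₁.2.2⟩, hh₁.1, fun htX => ht ?_⟩
      by_cases htS : D.reachingRoots R (D.tail a) = S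
      · exact Or.inl ⟨htX, D.tail_mem a ha, htS⟩
      · exact Or.inr ⟨D.tail_mem a ha, _, ⟨htX, htS⟩, Relation.ReflTransGen.refl⟩
    have hspan : (X₁ ∪ D.reachingSet X₂) ∩ R ⊆
        ⋃ y ∈ X, D.levelSpan R (fun r => {r}) S y := by
      rintro r ⟨hr | ⟨hrD, y, hy, hry⟩, hrR⟩
      · refine Set.mem_biUnion hr.1 ?_
        rw [levelSpan, if_pos hr.2.2]
        exact ⟨hrR, rfl⟩
      · refine Set.mem_biUnion hy.1 ?_
        rw [levelSpan, if_neg hy.2]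
        exact (mem_reachingRoots hR).2 ⟨hrR, hry⟩
    have hfin := entering_finite D.tail D.head (A := D.levelArcs R (fun _ => ∅) S)
      (hA.subset fun a ha => ha.1.1) X
    have : M.eRk S ≤ (entering D.tail D.head (D.levelArcs R (fun _ => ∅) S) X).encard +
        M.eRk (⋃ y ∈ X, D.levelSpan R (fun r => {r}) S y) :=
      (M.eRk_mono hS).trans (hY.trans (add_le_add (Set.encard_le_encard hin) (M.eRk_mono hspan)))
    rw [← hfin.cast_ncard_eq, ← M.coe_natRk, ← M.coe_natRk] at this
    exact_mod_cast this
  · refine le_add_left (M.natRk_mono ?_)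
    rw [← hxS, hD.reachingRoots_root hxR, Set.singleton_subset_iff]
    refine Set.mem_biUnion hxX ?_
    rw [levelSpan, if_pos (hD.reachingRoots_root hxR)]
    exact ⟨hxR, rfl⟩

/-- An extendable partial packing in which some vertex is not yet saturated can be extended by one
arc. The arc is chosen on a minimal level containing an unsaturated vertex, so that the tails of the
arcs entering this level lie on it or are saturated. -/
lemma IsExtendable.exists_extension [M.RankFinite] (hV : D.vertexSet.Finite)
    (hA : D.arcSet.Finite) (hD : D.IsMatroidRooted V R M) (hE : D.IsExtendable V R M N C)
    (hdef : ∃ v ∈ D.vertexSet, ¬ D.reachingRoots R v ⊆ M.closure (rootsAt R N v)) :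
    ∃ (N' : α → Set α) (C' : α → Set β), D.IsExtendable V R M N' C' ∧
      D.unused R C' ⊂ D.unused R C := by
  classical
  have hR := hD.subset_vertexSet
  have hTE : ∀ x, D.reachingRoots R x ⊆ M.E := fun x => by
    rw [hD.ground_eq]
    exact Set.inter_subset_right
  have hfT := rootsAt_subset hR hE.isGrown
  obtain ⟨v, ⟨hvD, hvdef⟩, hmin⟩ := Set.Finite.exists_minimalFor (D.reachingRoots R)
    {v | v ∈ D.vertexSet ∧ ¬ D.reachingRoots R v ⊆ M.closure (rootsAt R N v)}
    (hV.subset fun x hx => hx.1) hdef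
  set S := D.reachingRoots R v with hS
  let Z : Set α := {x | x ∈ D.vertexSet ∧ D.reachingRoots R x ⊆ S}
  have hspanT : ∀ S' y, D.levelSpan R N S' y ⊆ D.reachingRoots R y := by
    intro S' y
    rw [levelSpan]
    split_ifs
    exacts [hfT y, subset_rfl]
  have hspan : ∀ x ∈ Z, D.levelSpan R N S x ⊆ M.closure (rootsAt R N x) := by
    rintro x ⟨hxD, hxS⟩
    rw [levelSpan]
    split_ifs with hx
    · exact M.subset_closure _ ((hfT x).trans (hTE x))
    · by_contra hn
      exact hx (hxS.antisymm (hmin ⟨hxD, hn⟩ hxS))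
  obtain ⟨a, ⟨⟨haD, haC⟩, haS⟩, s, ⟨hsR, hsN⟩, hscl, hcut⟩ := exists_safe_arc M
    (A := D.levelArcs R C S) (hA.subset fun a ha => ha.1.1) D.tail D.head (Z := Z)
    (K := D.level R S) (F := D.levelSpan R N S) (G := rootsAt R N) (k := M.natRk S)
    (hV.subset fun x hx => hx.1) (fun x hx => ⟨hx.1, hx.2.subset⟩)
    (fun a ha => ⟨D.head_mem a ha.1.1, ha.2⟩)
    (fun a ha => ⟨D.tail_mem a ha.1.1, ha.2 ▸ reachingRoots_tail_subset hR ha.1.1⟩)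
    (fun x => (hspanT S x).trans (hTE x))
    (fun x => by
      rw [levelSpan]
      split_ifs
      exacts [subset_rfl, hfT x])
    hspan (hE.cut S)
    (M.natRk_mono (Set.iUnion₂_subset fun x hx => (hspanT S x).trans hx.2))
    (v := v) ⟨hvD, rfl⟩
    (by
      rw [levelSpan, if_pos rfl]
      by_contra! hle
      exact hvdef (Matroid.subset_closure_of_natRk_le (hfT v) (hTE v) hle))
  rw [levelSpan, if_pos haS] at hscl
  have hsE : s ∈ M.E := by rwa [hD.ground_eq]
  have hsf : s ∉ rootsAt R N (D.head a) := fun h =>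
    hscl (M.subset_closure _ ((hfT _).trans (hTE _)) h)
  have hhN : D.head a ∉ N s := fun h => hsf ⟨hsR, h⟩
  let N' : α → Set α := Function.update N s (insert (D.head a) (N s))
  let C' : α → Set β := Function.update C s (insert a (C s))
  have hN'C' : ∀ r ∈ R, D.IsGrown r (N' r) (C' r) := by
    intro r hr
    by_cases hrs : r = s
    · subst hrs
      simp only [N', C', Function.update_self]
      exact (hE.isGrown r hr).step haD hsN hhN
    · simp only [N', C', Function.update_of_ne hrs]
      exact hE.isGrown r hr
  have hroots : ∀ x, x ≠ D.head a → rootsAt R N' x = rootsAt R N x := by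
    intro x hx
    ext r
    by_cases hrs : r = s
    · subst hrs
      simp [rootsAt, N', hx]
    · simp [rootsAt, N', hrs]
  have hroots_head : rootsAt R N' (D.head a) = insert s (rootsAt R N (D.head a)) := by
    ext r
    by_cases hrs : r = s
    · subst hrs
      simp [rootsAt, N', hsR]
    · simp [rootsAt, N', hrs]
  have hunused : D.unused R C' = D.unused R C \ {a} := by
    ext b
    simp only [unused, Set.mem_sdiff, Set.mem_ofPred_eq, Set.mem_singleton_iff]
    constructor
    · rintro ⟨hb, hbC⟩
      refine ⟨⟨hb, fun r hr hbr => hbC r hr ?_⟩, ?_⟩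
      · by_cases hrs : r = s
        · subst hrs
          simp only [C', Function.update_self]
          exact Or.inr hbr
        · simpa only [C', Function.update_of_ne hrs] using hbr
      · rintro rfl
        refine hbC s hsR ?_
        simp only [C', Function.update_self]
        exact Or.inl rfl
    · rintro ⟨⟨hb, hbC⟩, hba⟩
      refine ⟨hb, fun r hr hbr => ?_⟩
      by_cases hrs : r = s
      · subst hrs
        simp only [C', Function.update_self] at hbr
        exact hbr.elim hba (hbC r hr)
      · simp only [C', Function.update_of_ne hrs] at hbr
        exact hbC r hr hbr
  refine ⟨N', C', ⟨hN'C', ?_, ?_, ?_⟩, ?_⟩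
  · intro r hr t ht hrt
    change Disjoint (C' r) (C' t)
    by_cases hrs : r = s
    · subst hrs
      simp only [C', Function.update_self, Function.update_of_ne hrt.symm]
      exact Set.disjoint_insert_left.2 ⟨haC t ht, hE.arcDisjoint hr ht hrt⟩
    · by_cases hts : t = s
      · subst hts
        simp only [C', Function.update_self, Function.update_of_ne hrs]
        exact Set.disjoint_insert_right.2 ⟨haC r hr, hE.arcDisjoint hr ht hrt⟩
      · simp only [C', Function.update_of_ne hrs, Function.update_of_ne hts]
        exact hE.arcDisjoint hr ht hrt
  · intro x hx
    by_cases hxa : x = D.head a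
    · subst hxa
      rw [hroots_head]
      exact ((hE.indep _ hx).insert_indep_iff_of_notMem hsf).2 ⟨hsE, hscl⟩
    · rw [hroots x hxa]
      exact hE.indep x hx
  · intro S' X hX
    by_cases hSS : S' = S
    · rw [hSS] at hX ⊢
      have harcs : D.levelArcs R C' S = D.levelArcs R C S \ {a} := by
        ext b
        simp only [levelArcs, hunused, Set.mem_sdiff, Set.mem_ofPred_eq, Set.mem_singleton_iff]
        tauto
      rw [harcs]
      refine hcut _ (fun x => ?_) ?_ X hX
      · rw [levelSpan, levelSpan]
        split_ifs
        · by_cases hxa : x = D.head a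
          · subst hxa
            rw [hroots_head]
            exact Set.subset_insert _ _
          · rw [hroots x hxa]
        · exact subset_rfl
      · rw [levelSpan, if_pos haS, hroots_head]
        exact Set.mem_insert _ _
    · have harcs : D.levelArcs R C' S' = D.levelArcs R C S' := by
        ext b
        simp only [levelArcs, hunused, Set.mem_sdiff, Set.mem_ofPred_eq, Set.mem_singleton_iff]
        refine ⟨fun h => ⟨h.1.1, h.2⟩, fun h => ⟨⟨h.1, ?_⟩, h.2⟩⟩
        rintro rfl
        exact hSS (h.2.symm.trans haS)
      have hsp : D.levelSpan R N' S' = D.levelSpan R N S' := by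
        ext1 x
        rw [levelSpan, levelSpan]
        split_ifs with hx
        · refine hroots x ?_
          rintro rfl
          exact hSS (hx.symm.trans haS)
        · rfl
      rw [harcs, hsp]
      exact hE.cut S' X hX
  · rw [hunused]
    exact ⟨Set.sdiff_subset, fun h => (h ⟨haD, haC⟩).2 rfl⟩

lemma IsExtendable.exists_saturated [M.RankFinite] (hV : D.vertexSet.Finite)
    (hA : D.arcSet.Finite) (hD : D.IsMatroidRooted V R M) (hE : D.IsExtendable V R M N C) :
    ∃ (N' : α → Set α) (C' : α → Set β), D.IsExtendable V R M N' C' ∧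
      ∀ v ∈ D.vertexSet, D.reachingRoots R v ⊆ M.closure (rootsAt R N' v) := by
  induction hn : (D.unused R C).ncard using Nat.strong_induction_on generalizing N C with
  | _ n ih =>
    by_cases hdef : ∃ v ∈ D.vertexSet, ¬ D.reachingRoots R v ⊆ M.closure (rootsAt R N v)
    · obtain ⟨N', C', hE', hlt⟩ := hE.exists_extension hV hA hD hdef
      exact ih _ (hn ▸ Set.ncard_lt_ncard hlt (hA.subset fun a ha => ha.1)) hE' rfl
    · push Not at hdef
      exact ⟨N, C, hE, hdef⟩

open Classical in
theorem IsMatroidRooted.exists_packing (hV : D.vertexSet.Finite) (hA : D.arcSet.Finite)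
    (hD : D.IsMatroidRooted V R M)
    (h : ∀ X : Set α, X ⊆ V ∪ R → (X ∩ V).Nonempty →
      M.eRk (D.reachingSet X ∩ R) ≤ D.inDeg X + M.eRk (X ∩ R)) :
    ∃ B : α → MultiDigraph α β, D.IsMatroidReachabilityBasedPacking V R M B := by
  have hR := hD.subset_vertexSet
  have hfin : M.Finite := ⟨by rw [hD.ground_eq]; exact hV.subset hR⟩
  obtain ⟨N, C, hE, hsat⟩ := (hD.isExtendable_init hA h).exists_saturated hV hA hD
  let B : α → MultiDigraph α β := fun r =>
    if hr : r ∈ R then (hE.isGrown r hr).toDigraph else D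
  have hB : ∀ r (hr : r ∈ R), B r = (hE.isGrown r hr).toDigraph := fun r hr => dif_pos hr
  refine ⟨B, ⟨fun r hr => ?_, fun r hr => ?_, fun r hr s hs hrs => ?_⟩, fun v hv => ?_⟩
  · rw [hB r hr]
    exact (hE.isGrown r hr).isSubdigraph (hR hr)
  · rw [hB r hr]
    exact (hE.isGrown r hr).isArborescenceFrom
      (hV.subset ((hE.isGrown r hr).subset_vertexSet (hR hr)))
  · change Disjoint (B r).arcSet (B s).arcSet
    rw [hB r hr, hB s hs]
    exact hE.arcDisjoint hr hs hrs
  · have hroots : {r | r ∈ R ∧ v ∈ (B r).vertexSet} = rootsAt R N v := by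
      ext r
      refine and_congr_right fun hr => ?_
      rw [hB r hr]
      rfl
    rw [hroots]
    have hvD : v ∈ D.vertexSet := by
      rw [hD.vertexSet_eq]
      exact Or.inl hv
    exact (hE.indep v hv).isBasis_of_subset_of_subset_closure (rootsAt_subset hR hE.isGrown v)
      (hsat v hvD)

end Sufficiency

end MultiDigraph

theorem mainTheorem4 {α β : Type*} (D : MultiDigraph α β) (V R : Set α) (M : Matroid α)
    (hV : D.vertexSet.Finite) (hA : D.arcSet.Finite) (hD : D.IsMatroidRooted V R M) :
    (∃ B : α → MultiDigraph α β, D.IsMatroidReachabilityBasedPacking V R M B) ↔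
      ∀ X : Set α, X ⊆ V ∪ R → (X ∩ V).Nonempty →
        M.eRk (D.reachingSet X ∩ R) ≤ D.inDeg X + M.eRk (X ∩ R) :=
  ⟨fun ⟨_, hB⟩ _ hX _ => hB.eRk_le hD hX, hD.exists_packing hV hA⟩
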